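/- Setting. Let $\mathcal V\subseteq\mathbb R^d$ be Borel measurable, let $\mathcal X$ be a Borel subset of a complete separable metric space, and let $(F_v:v\in\mathcal V)$ be probability measures on $\mathcal X$. For $k\in\{1,2,\ldots\}$ let $\Delta_k=\{w\in(0,\infty)^k:\sum_{i=1}^k w_i=1\}$ (so $\Delta_1=\{1\}$), and for $w\in\Delta_k$, $v\in\mathcal V^k$ let $P_{w,v}=\sum_{i=1}^k w_iF_{v_i}$. Let $\Theta_k=\Delta_k\times\mathcal V^k$ and let $\Theta=\bigcup_{k\ge1}\Theta_k$ be the disjoint union; for $\theta=(w,v)\in\Theta_k$ write $k(\theta)=k$, $P_\theta=P_{w,v}$, and, for a permutation $\sigma\in S_k$, $\theta[\sigma]=(w_\sigma,v_\sigma)$ with $w_\sigma=(w_{\sigma_1},\ldots,w_{\sigma_k})$ and $v_\sigma=(v_{\sigma_1},\ldots,v_{\sigma_k})$. Let $d_\Theta(\theta,\theta')=\min\{\|\theta-\theta'\|,1\}$ (Euclidean norm) if $k(\theta)=k(\theta')$ and $d_\Theta(\theta,\theta')=1$ otherwise; give $\Theta$ the Borel $\sigma$-algebra of this metric. For $\theta_0\in\Theta_k$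 and $\varepsilon>0$ let $\tilde B(\theta_0,\varepsilon)=\bigcup_{\sigma\in S_k}\{\theta\in\Theta:d_\Theta(\theta,\theta_0[\sigma])<\varepsilon\}$. Model. Let $\pi$, $D_k$, $G_k$ be probability measures on $\{1,2,\ldots\}$, $\Delta_k$ and $\mathcal V^k$. Let $K\sim\pi$; given $K=k$, let $W\sim D_k$ and $V\sim G_k$ be independent; put $\boldsymbol\theta=(W,V)$; given $\boldsymbol\theta$, let $X_1,X_2,\ldots$ be i.i.d. from $P_{\boldsymbol\theta}$. For each $n$ fix a regular conditional distribution of $\boldsymbol\theta$ given $X_1,\ldots,X_n$ under this model; it is a function of the data $(X_1,\ldots,X_n)$ and is denoted $\Pr(\,\cdot\mid X_1,\ldots,X_n)$ below. Assumptions on the family. (a) $v\mapsto F_v(A)$ is measurable for every measurable $A\subseteq\mathcal X$. (b) For all $k,k'\ge1$, $w\in\Delta_k$, $w'\in\Delta_{k'}$, $v\in\mathcal V^k$, $v'\in\mathcal V^{k'}$: if $P_{w,v}=P_{w',v'}$ then $\sum_{i=1}^k w_i\delta_{v_i}=\sum_{i=1}^{k'}w'_i\delta_{v'_i}$. Assumptions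 on the prior, for every $k\ge1$. (c) $\pi(\{k\})>0$. (d) For every measurable $A\subseteq\Delta_k$ with $D_k(A)=0$, the set $\{(w_1,\ldots,w_{k-1}):w\in A\}$ has Lebesgue measure zero in $\mathbb R^{k-1}$. (e) For every measurable $A\subseteq\mathcal V^k$ with $\sum_{\sigma\in S_k}G_k(\{v:v_\sigma\in A\})=0$, $A$ has Lebesgue measure zero. (f) $G_k(\{v:v_i=v_j\})=0$ for all $1\le i<j\le k$. Lebesgue measure on $\Theta$. Let $\lambda_{\Delta_k}(A)$ be the $(k-1)$-dimensional Lebesgue measure of $\{(w_1,\ldots,w_{k-1}):w\in A\}$, let $\lambda_{\mathcal V^k}$ be Lebesgue measure on $\mathcal V^k$, and let $\lambda(A)=\sum_{k=1}^\infty(\lambda_{\Delta_k}\times\lambda_{\mathcal V^k})(A\cap\Theta_k)$. Theorem. Under (a)–(f) there is a measurable set $\Theta_*\subseteq\Theta$ with $\Pr(\boldsymbol\theta\in\Theta_*)=1$ and $\lambda(\Theta\setminus\Theta_*)=0$ such that for every $\theta_0\in\Theta_*$, if $X_1,X_2,\ldots\sim P_{\theta_0}$ i.i.d., then for every $\varepsilon>0$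 $$\lim_{n\to\infty}\Pr\big(\boldsymbol\theta\in\tilde B(\theta_0,\varepsilon)\mid X_1,\ldots,X_n\big)=1\quad\text{almost surely},$$ and $$\lim_{n\to\infty}\Pr\big(K=k(\theta_0)\mid X_1,\ldots,X_n\big)=1\quad\text{almost surely}.$$ -/

import Mathlib

open MeasureTheory ProbabilityTheory Filter Topology
open scoped ENNReal BigOperators

noncomputable section

namespace FiniteMixture

/-- The weight space `Δ_k`: vectors `w ∈ ℝ^k` with strictly positive entries that sum to one.
For `k ≥ 2` all entries then lie in `(0, 1)`; for `k = 1` the only point is `w = (1)`. -/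
def weightSet (k : ℕ) : Set (Fin k → ℝ) :=
  {w | (∀ i, 0 < w i) ∧ ∑ i, w i = 1}

/-- `Δ_k` as a type, with the Borel sigma-algebra it inherits from `ℝ^k`. -/
abbrev Weights (k : ℕ) : Type := weightSet k

lemma measurableSet_weightSet (k : ℕ) : MeasurableSet (weightSet k) := by
  have h : weightSet k = (⋂ i, {w : Fin k → ℝ | 0 < w i}) ∩ {w | ∑ i, w i = 1} := by
    ext w; simp [weightSet]
  rw [h]
  refine (MeasurableSet.iInter fun i => ?_).inter ?_
  · exact measurableSet_lt measurable_const (measurable_pi_apply i)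
  · exact measurableSet_eq_fun (by fun_prop) measurable_const

/-- `(w_1, …, w_k) ↦ (w_σ(1), …, w_σ(k))` on `Δ_k`. -/
def Weights.permute {k : ℕ} (w : Weights k) (σ : Equiv.Perm (Fin k)) : Weights k :=
  ⟨fun i => w.1 (σ i), fun i => w.2.1 (σ i), by
    rw [Equiv.sum_comp σ (fun i => w.1 i)]; exact w.2.2⟩

/-- `w_{1:k-1} = (w_1, …, w_{k-1})`. -/
def Weights.truncate {k : ℕ} (w : Weights k) : Fin (k - 1) → ℝ :=
  fun i => w.1 (Fin.castLE (Nat.sub_le k 1) i)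

variable {d : ℕ}

/-- The parameter space `Θ = ⋃_k Δ_k × V^k` (a disjoint union over `k ∈ {1, 2, …}`). It carries
the sigma-algebra of the disjoint union: a set is measurable if and only if its part in each
`Δ_k × V^k` is Borel. This is the Borel sigma-algebra of the metric `paramDist` below. -/
abbrev Param (V : Set (EuclideanSpace ℝ (Fin d))) : Type :=
  Σ k : ℕ+, Weights k × (Fin k → V)

namespace Param

variable {V : Set (EuclideanSpace ℝ (Fin d))}

/-- The number of components `k(θ)`. -/
def numComponents (θ : Param V) : ℕ+ := θ.1

/-- The mixture weights of `θ`. -/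
def weight (θ : Param V) (i : Fin θ.numComponents) : ℝ := θ.2.1.1 i

/-- The component parameters of `θ`. -/
def component (θ : Param V) (i : Fin θ.numComponents) : V := θ.2.2 i

/-- `θ[σ] = (w_σ, v_σ)`. -/
def permute (θ : Param V) (σ : Equiv.Perm (Fin θ.numComponents)) : Param V :=
  ⟨θ.1, θ.2.1.permute σ, fun i => θ.2.2 (σ i)⟩

end Param

variable {V : Set (EuclideanSpace ℝ (Fin d))}

/-- The metric `d_Θ`: the Euclidean distance in `ℝ^{k + kd}` truncated at `1` if both parameters
have `k` components, and `1` if their numbers of components differ. -/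
def paramDist (θ θ' : Param V) : ℝ :=
  if h : θ.numComponents = θ'.numComponents then
    min (Real.sqrt
      (∑ i, (θ.weight i - θ'.weight (Fin.cast (congrArg PNat.val h) i)) ^ 2 +
        ∑ i, ‖(θ.component i : EuclideanSpace ℝ (Fin d)) -
          θ'.component (Fin.cast (congrArg PNat.val h) i)‖ ^ 2)) 1
  else 1

/-- The neighbourhood `B̃(θ₀, ε)`: the union over all permutations `σ` of the component labels of
the `d_Θ`-balls of radius `ε` around `θ₀[σ]`. -/
def permBall (θ₀ : Param V) (ε : ℝ) : Set (Param V) :=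
  ⋃ σ : Equiv.Perm (Fin θ₀.numComponents), {θ | paramDist θ (θ₀.permute σ) < ε}

/-- The measure `λ_{Δ_k}`: the Lebesgue measure of `{w_{1:k-1} : w ∈ A} ⊆ ℝ^{k-1}`. -/
def lebesgueWeights (k : ℕ) : Measure (Weights k) :=
  Measure.comap Weights.truncate (volume : Measure (Fin (k - 1) → ℝ))

/-- The measure `λ_{V^k}`: Lebesgue measure on `(ℝ^d)^k`, restricted to `V^k`. -/
def lebesgueComponents (V : Set (EuclideanSpace ℝ (Fin d))) (k : ℕ) : Measure (Fin k → V) :=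
  Measure.comap (fun v i => (v i : EuclideanSpace ℝ (Fin d)))
    (volume : Measure (Fin k → EuclideanSpace ℝ (Fin d)))

/-- The measure `λ` on `Θ`, `λ(A) = ∑_k (λ_{Δ_k} × λ_{V^k})(A ∩ Θ_k)`. -/
def lebesgueParam (V : Set (EuclideanSpace ℝ (Fin d))) : Measure (Param V) :=
  Measure.sum fun k : ℕ+ =>
    ((lebesgueWeights k).prod (lebesgueComponents V k)).map (Sigma.mk k)

variable {𝕏 : Type*} [MeasurableSpace 𝕏]

/-- The finite mixture `P_{w,v} = ∑_i w_i F_{v_i}`. -/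
def mixture (F : V → Measure 𝕏) {k : ℕ} (w : Weights k) (v : Fin k → V) : Measure 𝕏 :=
  ∑ i, ENNReal.ofReal (w.1 i) • F (v i)

/-- The discrete mixing distribution `∑_i w_i δ_{v_i}` on `V`. -/
def mixingDistribution {k : ℕ} (w : Weights k) (v : Fin k → V) : Measure V :=
  ∑ i, ENNReal.ofReal (w.1 i) • Measure.dirac (v i)

/-- The data distribution `P_θ = P_{w,v}` for `θ = (w, v)`. -/
def dataLaw (F : V → Measure 𝕏) (θ : Param V) : Measure 𝕏 :=
  mixture F θ.2.1 θ.2.2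

/-- The condition on the family of component distributions. -/
structure ComponentCondition (F : V → Measure 𝕏) : Prop where
  /-- `v ↦ F_v(A)` is measurable on `V` for all measurable `A`. -/
  measurable_apply : ∀ A : Set 𝕏, MeasurableSet A → Measurable fun v => F v A
  /-- Finite mixture identifiability. -/
  identifiable : ∀ (k k' : ℕ+) (w : Weights k) (w' : Weights k')
    (v : Fin k → V) (v' : Fin k' → V),
    mixture F w v = mixture F w' v' → mixingDistribution w v = mixingDistribution w' v'

/-- The condition on the prior, given by the law `π` of `K` and the conditional laws `D k` of the
weights and `G k` of the component parameters given `K = k`. -/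
structure PriorCondition (π : PMF ℕ+) (D : ∀ k : ℕ+, Measure (Weights k))
    (G : ∀ k : ℕ+, Measure (Fin k → V)) : Prop where
  /-- Every number of components has positive prior probability. -/
  pos : ∀ k : ℕ+, 0 < π k
  /-- Sets of weights of prior probability zero are Lebesgue-null. -/
  weights : ∀ (k : ℕ+) (A : Set (Weights k)), MeasurableSet A → D k A = 0 →
    (volume : Measure (Fin ((k : ℕ) - 1) → ℝ)) (Weights.truncate '' A) = 0
  /-- Sets of component parameters that have prior probability zero under every relabelling of
  the components are Lebesgue-null. -/
  components : ∀ (k : ℕ+) (A : Set (Fin k → V)), MeasurableSet A →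
    ∑ σ : Equiv.Perm (Fin k), G k {v | (fun i => v (σ i)) ∈ A} = 0 →
    lebesgueComponents V k A = 0
  /-- The component parameters are almost surely distinct. -/
  distinct : ∀ (k : ℕ+) (i j : Fin k), i < j → G k {v | v i = v j} = 0

/-- The prior law of `θ = (W, V)`: first `K ∼ π`, then, given `K = k`, the weights and the
component parameters are drawn independently from `D k` and `G k`. -/
def priorLaw (π : PMF ℕ+) (D : ∀ k : ℕ+, Measure (Weights k))
    (G : ∀ k : ℕ+, Measure (Fin k → V)) : Measure (Param V) :=
  Measure.sum fun k : ℕ+ => π k • ((D k).prod (G k)).map (Sigma.mk k)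

/-- The joint law of `((X_1, …, X_n), θ)` when `θ ∼ Q` and, given `θ`, the observations
`X_1, …, X_n` are i.i.d. from `P_θ`. -/
def jointLaw (F : V → Measure 𝕏) (Q : Measure (Param V)) (n : ℕ) :
    Measure ((Fin n → 𝕏) × Param V) :=
  Q.bind fun θ => (Measure.pi fun _ : Fin n => dataLaw F θ).map fun x => (x, θ)

instance standardBorelSpace_weights (k : ℕ) : StandardBorelSpace (Weights k) := (measurableSet_weightSet k).standardBorel

lemma Weights.truncate_measurable (k : ℕ) : Measurable (Weights.truncate : Weights k → _) := by
  exact measurable_pi_lambda _ fun i => (measurable_pi_apply _).comp measurable_subtype_coe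

lemma Weights.truncate_injective (k : ℕ) :
    Function.Injective (Weights.truncate : Weights k → _) := by
  intro w w' h
  have h1 : ∀ i : Fin k, (i : ℕ) < k - 1 → w.1 i = w'.1 i := fun i hi => congrFun h ⟨i, hi⟩
  rcases k with _ | k
  · exact Subtype.ext (funext fun i => i.elim0)
  have h2 : ∀ i : Fin k, w.1 i.castSucc = w'.1 i.castSucc := fun i => h1 _ (by simp)
  have e := w.2.2.trans w'.2.2.symm
  rw [Fin.sum_univ_castSucc, Fin.sum_univ_castSucc, Finset.sum_congr rfl fun i _ => h2 i] at e
  refine Subtype.ext (funext fun i => ?_)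
  induction i using Fin.lastCases with
  | last => exact add_left_cancel e
  | cast i => exact h2 i

/-- `λ_{Δ_k}(A)` is the Lebesgue measure of `{w_{1:k-1} : w ∈ A}`. -/
lemma lebesgueWeights_apply (k : ℕ) (A : Set (Weights k)) :
    lebesgueWeights k A = volume (Weights.truncate '' A) :=
  ((Weights.truncate_measurable k).measurableEmbedding
    (Weights.truncate_injective k)).comap_apply _ _

/-- `λ_{V^k}(A)` is the Lebesgue measure of `A`, seen as a subset of `(ℝ^d)^k`. -/
lemma lebesgueComponents_apply (hV : MeasurableSet V) (k : ℕ) (A : Set (Fin k → V)) :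
    lebesgueComponents V k A = volume ((fun v i => (v i : EuclideanSpace ℝ (Fin d))) '' A) := by
  have : StandardBorelSpace V := hV.standardBorel
  refine MeasurableEmbedding.comap_apply (Measurable.measurableEmbedding (by fun_prop) ?_) _ _
  exact fun v v' h => funext fun i => Subtype.ext (congrFun h i)

instance dataLaw_isProbabilityMeasure (F : V → Measure 𝕏) [∀ v, IsProbabilityMeasure (F v)]
    (θ : Param V) : IsProbabilityMeasure (dataLaw F θ) := by
  constructor
  simp only [dataLaw, mixture, Measure.coe_finsetSum, Finset.sum_apply, Measure.smul_apply,
    measure_univ, smul_eq_mul, mul_one]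
  rw [← ENNReal.ofReal_sum_of_nonneg fun i _ => (θ.2.1.2.1 i).le, θ.2.1.2.2,
    ENNReal.ofReal_one]

lemma measurable_sigmaMk (k : ℕ+) :
    Measurable fun x : Weights k × (Fin k → V) => (⟨k, x⟩ : Param V) :=
  measurable_iff_le_map.2 (iInf_le _ k)

lemma measurable_sigma {β : Type*} [MeasurableSpace β] {f : Param V → β}
    (hf : ∀ k : ℕ+, Measurable fun x : Weights k × (Fin k → V) => f ⟨k, x⟩) : Measurable f :=
  fun _ hs => MeasurableSpace.measurableSet_iInf.2 fun k => hf k hs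

lemma measurable_dataLaw (F : V → Measure 𝕏)
    (hF : ∀ A : Set 𝕏, MeasurableSet A → Measurable fun v => F v A)
    {A : Set 𝕏} (hA : MeasurableSet A) : Measurable fun θ : Param V => dataLaw F θ A := by
  refine measurable_sigma fun k => ?_
  simp only [dataLaw, mixture, Measure.coe_finsetSum, Finset.sum_apply,
    Measure.smul_apply, smul_eq_mul]
  change Measurable fun x : Weights k × (Fin k → V) =>
    ∑ i : Fin k, ENNReal.ofReal (x.1.1 i) * F (x.2 i) A
  refine Finset.measurable_fun_sum _ fun i _ => ?_
  refine Measurable.mul ?_ ?_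
  · exact ENNReal.measurable_ofReal.comp
      ((measurable_pi_apply i).comp (measurable_subtype_coe.comp measurable_fst))
  · exact (hF A hA).comp ((measurable_pi_apply i).comp measurable_snd)

lemma measurable_pi_dataLaw (F : V → Measure 𝕏) [∀ v, IsProbabilityMeasure (F v)]
    (hF : ∀ A : Set 𝕏, MeasurableSet A → Measurable fun v => F v A) (n : ℕ) :
    Measurable fun θ : Param V => Measure.pi fun _ : Fin n => dataLaw F θ := by
  refine Measurable.measure_of_isPiSystem_of_isProbabilityMeasure
    generateFrom_pi.symm isPiSystem_pi ?_
  rintro _ ⟨s, hs, rfl⟩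
  simp only [Measure.pi_pi]
  exact Finset.measurable_prod _ fun i _ => measurable_dataLaw F hF (hs i (Set.mem_univ i))

/-- `P(X_{1:n} ∈ A, θ ∈ B) = ∫_B P_θ^n(A) dQ(θ)`. -/
lemma jointLaw_prod (F : V → Measure 𝕏) [∀ v, IsProbabilityMeasure (F v)]
    (hF : ∀ A : Set 𝕏, MeasurableSet A → Measurable fun v => F v A)
    (Q : Measure (Param V)) (n : ℕ) {A : Set (Fin n → 𝕏)} (hA : MeasurableSet A)
    {B : Set (Param V)} (hB : MeasurableSet B) :
    jointLaw F Q n (A ×ˢ B) = ∫⁻ θ in B, Measure.pi (fun _ : Fin n => dataLaw F θ) A ∂Q := by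
  have key : ∀ (S : Set (Fin n → 𝕏)) (T : Set (Param V)), MeasurableSet S → MeasurableSet T →
      ∀ θ : Param V,
      (Measure.pi fun _ : Fin n => dataLaw F θ).map (fun x => (x, θ)) (S ×ˢ T) =
        T.indicator (fun θ => Measure.pi (fun _ : Fin n => dataLaw F θ) S) θ := by
    intro S T hS hT θ
    rw [Measure.map_apply (by fun_prop) (hS.prod hT)]
    by_cases h : θ ∈ T <;> simp [h]
  have hm : Measurable fun θ : Param V =>
      (Measure.pi fun _ : Fin n => dataLaw F θ).map fun x => (x, θ) := by
    have : ∀ θ : Param V, IsProbabilityMeasure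
        ((Measure.pi fun _ : Fin n => dataLaw F θ).map fun x => (x, θ)) :=
      fun θ => Measure.isProbabilityMeasure_map (by fun_prop)
    refine Measurable.measure_of_isPiSystem_of_isProbabilityMeasure
      generateFrom_prod.symm isPiSystem_prod ?_
    rintro _ ⟨S, hS, T, hT, rfl⟩
    simp only [key S T hS hT]
    exact ((Measure.measurable_coe (s := S) hS).comp (measurable_pi_dataLaw F hF n)).indicator hT
  rw [jointLaw, Measure.bind_apply (hA.prod hB) hm.aemeasurable]
  simp only [key A B hA hB]
  exact lintegral_indicator hB _

end FiniteMixture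

end

/-! The argument is Doob's consistency theorem, adapted to parameters identifiable only up to
relabelling. For parameters with distinct components, which carry all the prior mass, `P_θ`
determines the mixing distribution, hence `θ` up to a permutation
(`exists_eq_permute_of_dataLaw_eq`). The law of large numbers recovers `P_θ` from an infinite sample
(`ae_limFreq_eq`). So membership of `θ` in a permutation invariant measurable set is almost surely a
measurable function of the data (`exists_measurableSet_mem_iff`), and martingale convergence sends
its posterior probability to the indicator (`ae_tendsto_posterior`).

Each such set costs a prior-null set of parameters. Saturating a countable basis of every `Θ_k`
under permutations gives countably many sets, which still supply a neighbourhood of `θ₀` inside each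
`permBall θ₀ ε`, so one null set suffices. This exceptional set is itself permutation invariant, and
that symmetry lets the prior assumptions make it Lebesgue-null (`lebesgueParam_eq_zero`). -/

namespace FiniteMixture

/-! ### Relabelling and identifiability up to permutation -/

section Permutation

variable {d : ℕ} {V : Set (EuclideanSpace ℝ (Fin d))}

lemma Param.permute_permute (θ : Param V) (σ τ : Equiv.Perm (Fin θ.numComponents)) :
    (θ.permute σ).permute τ = θ.permute (σ * τ) := rfl

lemma Param.permute_permute_inv (θ : Param V) (σ : Equiv.Perm (Fin θ.numComponents)) :
    (θ.permute σ).permute σ⁻¹ = θ := by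
  refine (θ.permute_permute σ σ⁻¹).trans ?_
  rw [mul_inv_cancel]
  rfl

/-- The parameters whose components are pairwise distinct. -/
def distinctParams (V : Set (EuclideanSpace ℝ (Fin d))) : Set (Param V) :=
  {θ | Function.Injective θ.2.2}

/-- A set of parameters that is closed under relabelling of the components. -/
def PermInvariant (B : Set (Param V)) : Prop :=
  ∀ θ ∈ B, ∀ σ, θ.permute σ ∈ B

lemma permInvariant_distinctParams : PermInvariant (distinctParams V) :=
  fun θ hθ σ => Function.Injective.comp (g := θ.2.2) hθ σ.injective

lemma PermInvariant.inter {B C : Set (Param V)} (hB : PermInvariant B) (hC : PermInvariant C) :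
    PermInvariant (B ∩ C) :=
  fun θ hθ σ => ⟨hB θ hθ.1 σ, hC θ hθ.2 σ⟩

lemma PermInvariant.compl {B : Set (Param V)} (hB : PermInvariant B) : PermInvariant Bᶜ := by
  intro θ hθ σ h
  refine hθ ?_
  exact θ.permute_permute_inv σ ▸ hB _ h σ⁻¹

lemma measurableSet_distinctParams : MeasurableSet (distinctParams V) := by
  refine MeasurableSpace.measurableSet_iInf.2 fun k => ?_
  change MeasurableSet {x : Weights k × (Fin k → V) | Function.Injective x.2}
  have h : {x : Weights k × (Fin k → V) | Function.Injective x.2} =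
      ⋂ i, ⋂ j, {x | x.2 i = x.2 j → i = j} := by
    ext x; simp [Function.Injective]
  rw [h]
  refine MeasurableSet.iInter fun i => MeasurableSet.iInter fun j => ?_
  by_cases hij : i = j
  · simp [hij]
  · simp only [hij, imp_false]
    exact (measurableSet_eq_fun (by fun_prop) (by fun_prop)).compl

lemma mixingDistribution_apply_singleton {k : ℕ} (w : Weights k) (v : Fin k → V)
    (x : V) : mixingDistribution w v {x} = ∑ i, if v i = x then ENNReal.ofReal (w.1 i) else 0 := by
  simp [mixingDistribution, Set.indicator_apply]

lemma mixingDistribution_apply_singleton_self {k : ℕ} (w : Weights k) {v : Fin k → V}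
    (hv : Function.Injective v) (i : Fin k) :
    mixingDistribution w v {v i} = ENNReal.ofReal (w.1 i) := by
  simp [mixingDistribution_apply_singleton, hv.eq_iff]

lemma mixingDistribution_singleton_pos_iff {k : ℕ} (w : Weights k) (v : Fin k → V) (x : V) :
    0 < mixingDistribution w v {x} ↔ x ∈ Set.range v := by
  rw [mixingDistribution_apply_singleton, Finset.sum_pos_iff]
  simp only [Finset.mem_univ, true_and, Set.mem_range]
  refine exists_congr fun i => ?_
  split_ifs with h <;> simp [h, w.2.1 i]

/-- Since all weights are positive, the atoms of the mixing distribution are exactly the components,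
and equal sets of atoms give a bijection of labels. As the components are distinct, the mass of each
atom is a single weight, so the bijection also matches the weights. -/
lemma exists_eq_permute {θ θ' : Param V} (hθ : θ ∈ distinctParams V)
    (hθ' : θ' ∈ distinctParams V)
    (h : mixingDistribution θ.2.1 θ.2.2 = mixingDistribution θ'.2.1 θ'.2.2) :
    ∃ σ, θ' = θ.permute σ := by
  obtain ⟨k, w, v⟩ := θ
  obtain ⟨k', w', v'⟩ := θ'
  change Function.Injective v at hθ
  change Function.Injective v' at hθ'
  simp only at h
  have hr : Set.range v' = Set.range v := by
    ext x
    rw [← mixingDistribution_singleton_pos_iff w, h, mixingDistribution_singleton_pos_iff]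
  let e : Fin k' ≃ Fin k :=
    (Equiv.ofInjective v' hθ').trans ((Equiv.setCongr hr).trans (Equiv.ofInjective v hθ).symm)
  have he : ∀ i, v (e i) = v' i := fun i =>
    Equiv.apply_ofInjective_symm hθ ⟨v' i, hr ▸ Set.mem_range_self i⟩
  obtain rfl : k' = k := PNat.eq (by simpa using Fintype.card_congr e)
  refine ⟨e, ?_⟩
  have hw : w' = w.permute e := by
    refine Subtype.ext (funext fun i => ?_)
    have h1 := mixingDistribution_apply_singleton_self w hθ (e i)
    rw [h, he, mixingDistribution_apply_singleton_self w' hθ'] at h1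
    exact (ENNReal.ofReal_eq_ofReal_iff (w'.2.1 i).le (w.2.1 _).le).1 h1
  have hv : v' = fun i => v (e i) := funext fun i => (he i).symm
  rw [hw, hv]
  rfl

variable {𝕏 : Type*} [MeasurableSpace 𝕏]

lemma dataLaw_permute (F : V → Measure 𝕏) (θ : Param V) (σ : Equiv.Perm (Fin θ.numComponents)) :
    dataLaw F (θ.permute σ) = dataLaw F θ :=
  Equiv.sum_comp σ fun i => ENNReal.ofReal (θ.2.1.1 i) • F (θ.2.2 i)

lemma exists_eq_permute_of_dataLaw_eq {F : V → Measure 𝕏} (hF : ComponentCondition F)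
    {θ θ' : Param V} (hθ : θ ∈ distinctParams V) (hθ' : θ' ∈ distinctParams V)
    (h : dataLaw F θ = dataLaw F θ') : ∃ σ, θ' = θ.permute σ :=
  exists_eq_permute hθ hθ' (hF.identifiable _ _ _ _ _ _ h)

end Permutation

/-! ### Measurable separation of invariant sets by the data law -/

section Separation

/-- A countably generated sigma-algebra has a countable family of measurable sets on which any
two probability measures can be told apart. -/
lemma exists_seq_measurableSet_separating (𝕏 : Type*) [MeasurableSpace 𝕏]
    [MeasurableSpace.CountablyGenerated 𝕏] :
    ∃ A : ℕ → Set 𝕏, (∀ m, MeasurableSet (A m)) ∧ ∀ μ ν : Measure 𝕏, IsProbabilityMeasure μ →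
      IsProbabilityMeasure ν → (∀ m, μ.real (A m) = ν.real (A m)) → μ = ν := by
  obtain ⟨b, hb, hgen⟩ := MeasurableSpace.CountablyGenerated.isCountablyGenerated (α := 𝕏)
  -- A countable generating family need not be a π-system; the algebra it generates is one, and is
  -- still countable.
  have hc := countable_generateSetAlgebra hb
  have halg := isSetAlgebra_generateSetAlgebra (𝒜 := b)
  obtain ⟨A, hA⟩ := hc.exists_eq_range ⟨∅, halg.empty_mem⟩
  have hgen' := hgen.trans (generateFrom_generateSetAlgebra_eq (𝒜 := b)).symm
  refine ⟨A, fun m => ?_, fun μ ν _ _ h => ?_⟩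
  · rw [hgen']
    exact MeasurableSpace.measurableSet_generateFrom (hA ▸ Set.mem_range_self m)
  · refine ext_of_generate_finite _ hgen' halg.isSetRing.isSetSemiring.isPiSystem ?_ (by simp)
    intro s hs
    rw [hA] at hs
    obtain ⟨m, rfl⟩ := hs
    exact (measureReal_eq_measureReal_iff).1 (h m)

variable {d : ℕ} {V : Set (EuclideanSpace ℝ (Fin d))} {𝕏 : Type*} [MeasurableSpace 𝕏]

lemma measurable_dataLaw_real_seq {F : V → Measure 𝕏} (hF : ComponentCondition F)
    {A : ℕ → Set 𝕏} (hA : ∀ m, MeasurableSet (A m)) :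
    Measurable fun (θ : Param V) m => (dataLaw F θ).real (A m) :=
  measurable_pi_lambda _ fun m =>
    (measurable_dataLaw F hF.measurable_apply (hA m)).ennreal_toReal

/-- `Θ` is a countable union of standard Borel pieces, and measurable images of Borel subsets of
each piece are analytic. -/
lemma analyticSet_image_param (hV : MeasurableSet V) {f : Param V → ℕ → ℝ} (hf : Measurable f)
    {B : Set (Param V)} (hB : MeasurableSet B) : AnalyticSet (f '' B) := by
  have : StandardBorelSpace V := hV.standardBorel
  have h : f '' B = ⋃ k : ℕ+, (fun x => f ⟨k, x⟩) '' ((fun x => (⟨k, x⟩ : Param V)) ⁻¹' B) := by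
    ext y
    simp only [Set.mem_image, Set.mem_iUnion, Sigma.exists, Set.mem_preimage]
  rw [h]
  exact AnalyticSet.iUnion fun k =>
    (measurable_sigmaMk k hB).analyticSet_image (hf.comp (measurable_sigmaMk k))

/-- On the parameters with distinct components, membership in a permutation invariant measurable
set is determined, measurably, by the values of `P_θ` on a separating sequence of sets. -/
lemma exists_measurableSet_mem_iff (hV : MeasurableSet V) {F : V → Measure 𝕏}
    [∀ v, IsProbabilityMeasure (F v)] (hF : ComponentCondition F)
    {A : ℕ → Set 𝕏} (hA : ∀ m, MeasurableSet (A m))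
    (hsep : ∀ μ ν : Measure 𝕏, IsProbabilityMeasure μ →
      IsProbabilityMeasure ν → (∀ m, μ.real (A m) = ν.real (A m)) → μ = ν)
    {B : Set (Param V)} (hB : MeasurableSet B) (hBinv : PermInvariant B) :
    ∃ C : Set (ℕ → ℝ), MeasurableSet C ∧
      ∀ θ ∈ distinctParams V, (θ ∈ B ↔ (fun m => (dataLaw F θ).real (A m)) ∈ C) := by
  have hT := measurable_dataLaw_real_seq hF hA
  have hdisj : Disjoint
      ((fun (θ : Param V) m => (dataLaw F θ).real (A m)) '' (distinctParams V ∩ B))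
      ((fun (θ : Param V) m => (dataLaw F θ).real (A m)) '' (distinctParams V ∩ Bᶜ)) := by
    rw [Set.disjoint_left]
    rintro _ ⟨θ, ⟨hθ, hθB⟩, rfl⟩ ⟨θ', ⟨hθ', hθ'B⟩, h⟩
    obtain ⟨σ, rfl⟩ := exists_eq_permute_of_dataLaw_eq hF hθ hθ'
      (hsep _ _ inferInstance inferInstance fun m => (congrFun h m).symm)
    exact hθ'B (hBinv θ hθB σ)
  -- A parameter and its relabellings have the same image, so the injective image theorem for Borel
  -- sets does not apply. Lusin's separation of disjoint analytic sets replaces it.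
  obtain ⟨C, hBC, hCB, hC⟩ := AnalyticSet.measurablySeparable
    (analyticSet_image_param hV hT (measurableSet_distinctParams.inter hB))
    (analyticSet_image_param hV hT (measurableSet_distinctParams.inter hB.compl)) hdisj
  refine ⟨C, hC, fun θ hθ => ⟨fun h => hBC ⟨θ, ⟨hθ, h⟩, rfl⟩, fun h => ?_⟩⟩
  by_contra hθB
  exact Set.disjoint_left.1 hCB ⟨θ, ⟨hθ, hθB⟩, rfl⟩ h

end Separation

end FiniteMixture

namespace FiniteMixture

/-! ### Recovering probabilities from empirical frequencies -/

section LawOfLargeNumbers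

variable {𝕏 : Type*} [MeasurableSpace 𝕏]

/-- The upper limit of the relative frequencies of the visits of a sequence to `A`. -/
noncomputable def limFreq (A : Set 𝕏) (x : ℕ → 𝕏) : ℝ :=
  limsup (fun n : ℕ => (∑ i ∈ Finset.range n, A.indicator (fun _ => (1 : ℝ)) (x i)) / n) atTop

lemma measurable_limFreq {A : Set 𝕏} (hA : MeasurableSet A) : Measurable (limFreq A) := by
  refine Measurable.limsup fun n => Measurable.div_const ?_ _
  exact Finset.measurable_fun_sum _ fun i _ =>
    (measurable_const.indicator hA).comp (measurable_pi_apply i)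

lemma ae_limFreq_eq (μ : Measure 𝕏) [IsProbabilityMeasure μ] {A : Set 𝕏} (hA : MeasurableSet A) :
    ∀ᵐ x ∂Measure.infinitePi fun _ : ℕ => μ, limFreq A x = μ.real A := by
  have hind : Measurable (A.indicator fun _ => (1 : ℝ)) := measurable_const.indicator hA
  have hmap : ∀ i : ℕ, (Measure.infinitePi fun _ : ℕ => μ).map (fun x => x i) = μ :=
    fun i => Measure.infinitePi_map_eval _ i
  have hmean : ∫ x, A.indicator (fun _ => (1 : ℝ)) (x 0) ∂Measure.infinitePi (fun _ : ℕ => μ) =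
      μ.real A := by
    rw [← integral_map (φ := fun x : ℕ → 𝕏 => x 0) (measurable_pi_apply 0).aemeasurable hind.aestronglyMeasurable,
      hmap, integral_indicator_const _ hA]
    simp
  have h := strong_law_ae_real (μ := Measure.infinitePi fun _ : ℕ => μ)
    (fun i x => A.indicator (fun _ => (1 : ℝ)) (x i)) ?_ ?_ ?_
  · filter_upwards [h] with x hx
    rw [hmean] at hx
    exact hx.limsup_eq
  · refine Integrable.of_bound (C := 1) ?_ (ae_of_all _ fun x => ?_)
    · exact (hind.comp (measurable_pi_apply 0)).aestronglyMeasurable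
    · by_cases hx : x 0 ∈ A <;> simp [hx]
  · exact fun i j hij => (iIndepFun_infinitePi (P := fun _ : ℕ => μ)
      (X := fun _ => A.indicator fun _ => (1 : ℝ)) fun _ => hind).indepFun hij
  · refine fun i => IdentDistrib.comp (u := A.indicator fun _ => (1 : ℝ))
      (f := fun x : ℕ → 𝕏 => x i) (g := fun x : ℕ → 𝕏 => x 0) ⟨?_, ?_, ?_⟩ hind
    · exact (measurable_pi_apply i).aemeasurable
    · exact (measurable_pi_apply 0).aemeasurable
    · rw [hmap, hmap]

end LawOfLargeNumbers

/-! ### The infinite i.i.d. sample as a kernel -/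

section DataKernel

variable {𝕏 : Type*} [MeasurableSpace 𝕏]

lemma map_fin_infinitePi (μ : Measure 𝕏) [IsProbabilityMeasure μ] (n : ℕ) :
    (Measure.infinitePi fun _ : ℕ => μ).map (fun x (i : Fin n) => x i) =
      Measure.pi fun _ => μ := by
  refine (Measure.pi_eq fun s hs => ?_).symm
  rw [Measure.map_apply (by fun_prop) (MeasurableSet.univ_pi hs)]
  have h : (fun (x : ℕ → 𝕏) (i : Fin n) => x i) ⁻¹' Set.univ.pi s =
      Set.pi (Finset.range n) fun j => if hj : j < n then s ⟨j, hj⟩ else Set.univ := by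
    ext x
    simp only [Set.mem_preimage, Set.mem_pi, Set.mem_univ, true_imp_iff, Finset.coe_range,
      Set.mem_Iio]
    refine ⟨fun h j hj => ?_, fun h i => ?_⟩
    · simpa [hj] using h ⟨j, hj⟩
    · simpa using h i i.2
  rw [h, Measure.infinitePi_pi, Finset.prod_range]
  · simp
  · intro j hj
    split_ifs with h
    exacts [hs _, MeasurableSet.univ]

variable {d : ℕ} {V : Set (EuclideanSpace ℝ (Fin d))}

lemma measurable_infinitePi_dataLaw {F : V → Measure 𝕏} [∀ v, IsProbabilityMeasure (F v)]
    (hF : ComponentCondition F) :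
    Measurable fun θ : Param V => Measure.infinitePi fun _ : ℕ => dataLaw F θ := by
  refine Measurable.measure_of_isPiSystem_of_isProbabilityMeasure
    (generateFrom_squareCylinders (α := fun _ : ℕ => 𝕏)).symm
    (isPiSystem_squareCylinders (fun _ => MeasurableSpace.isPiSystem_measurableSet)
      fun _ => MeasurableSet.univ) ?_
  intro S hS
  obtain ⟨s, t, ht, rfl⟩ := hS
  have : ∀ θ : Param V, Measure.infinitePi (fun _ : ℕ => dataLaw F θ) ((s : Set ℕ).pi t) =
      ∏ i ∈ s, dataLaw F θ (t i) := fun θ => Measure.infinitePi_pi _ fun i hi => ht i (Set.mem_univ i)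
  simp only [this]
  exact Finset.measurable_prod _ fun i hi =>
    measurable_dataLaw F hF.measurable_apply (ht i (Set.mem_univ i))

/-- The law of an infinite i.i.d. sample from `P_θ`, as a kernel. -/
noncomputable def dataKernel (F : V → Measure 𝕏) [∀ v, IsProbabilityMeasure (F v)]
    (hF : ComponentCondition F) : Kernel (Param V) (ℕ → 𝕏) :=
  ⟨fun θ => Measure.infinitePi fun _ : ℕ => dataLaw F θ, measurable_infinitePi_dataLaw hF⟩

lemma dataKernel_apply (F : V → Measure 𝕏) [∀ v, IsProbabilityMeasure (F v)]
    (hF : ComponentCondition F) (θ : Param V) :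
    dataKernel F hF θ = Measure.infinitePi fun _ : ℕ => dataLaw F θ := rfl

instance (F : V → Measure 𝕏) [∀ v, IsProbabilityMeasure (F v)]
    (hF : ComponentCondition F) : IsMarkovKernel (dataKernel F hF) :=
  ⟨fun θ => by rw [dataKernel_apply]; infer_instance⟩

/-- This places all the joint laws `jointLaw F Q n` on one probability space, where the posteriors
for different `n` form a martingale. -/
lemma map_compProd_dataKernel (F : V → Measure 𝕏) [∀ v, IsProbabilityMeasure (F v)]
    (hF : ComponentCondition F) (Q : Measure (Param V)) [IsProbabilityMeasure Q] (n : ℕ) :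
    (Q ⊗ₘ dataKernel F hF).map (fun ω => (fun i : Fin n => ω.2 i, ω.1)) = jointLaw F Q n := by
  have hm : Measurable fun ω : Param V × (ℕ → 𝕏) => ((fun i : Fin n => ω.2 i), ω.1) := by
    fun_prop
  refine Measure.ext_prod fun {S} {T} hS hT => ?_
  rw [Measure.map_apply hm (hS.prod hT), jointLaw_prod F hF.measurable_apply Q n hS hT]
  have h : (fun ω : Param V × (ℕ → 𝕏) => ((fun i : Fin n => ω.2 i), ω.1)) ⁻¹' S ×ˢ T =
      T ×ˢ ((fun (x : ℕ → 𝕏) (i : Fin n) => x i) ⁻¹' S) := by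
    ext ω; simp [and_comm]
  have hr : Measurable fun (x : ℕ → 𝕏) (i : Fin n) => x i := by fun_prop
  rw [h, Measure.compProd_apply_prod hT (hr hS)]
  refine lintegral_congr fun θ => ?_
  rw [dataKernel_apply, ← Measure.map_apply hr hS, map_fin_infinitePi]

end DataKernel

/-! ### Doob's theorem by martingale convergence -/

section Doob

variable {Θ 𝕏 : Type*} [MeasurableSpace Θ] [MeasurableSpace 𝕏]

/-- The filtration generated by the first `n` observations. -/
def obsFiltration (Θ 𝕏 : Type*) [MeasurableSpace Θ] [MeasurableSpace 𝕏] :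
    Filtration ℕ (inferInstance : MeasurableSpace (Θ × (ℕ → 𝕏))) where
  seq n := MeasurableSpace.comap (fun ω (i : Fin n) => ω.2 i) inferInstance
  mono' m n hmn := by
    have : Measurable fun (y : Fin n → 𝕏) (i : Fin m) => y (Fin.castLE hmn i) := by fun_prop
    rintro _ ⟨S, hS, rfl⟩
    exact ⟨_, this hS, rfl⟩
  le' n := Measurable.comap_le (by fun_prop)

lemma comap_snd_le_iSup_obsFiltration :
    MeasurableSpace.comap (Prod.snd : Θ × (ℕ → 𝕏) → ℕ → 𝕏) inferInstance ≤
      ⨆ n, obsFiltration Θ 𝕏 n := by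
  change MeasurableSpace.comap _ (⨆ i, MeasurableSpace.comap (fun x : ℕ → 𝕏 => x i) _) ≤ _
  rw [MeasurableSpace.comap_iSup]
  refine iSup_le fun i => ?_
  refine le_trans ?_ (le_iSup _ (i + 1))
  rw [MeasurableSpace.comap_comp]
  rintro _ ⟨S, hS, rfl⟩
  exact ⟨(fun y : Fin (i + 1) → 𝕏 => y (Fin.last i)) ⁻¹' S, measurable_pi_apply _ hS, rfl⟩

/-- **Doob's theorem**: if an event about the parameter is almost surely determined by the
infinite data sequence, then its posterior probability converges almost surely to its indicator. -/
theorem ae_tendsto_posterior (μ : Measure (Θ × (ℕ → 𝕏))) [IsProbabilityMeasure μ]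
    (post : ∀ n : ℕ, Kernel (Fin n → 𝕏) Θ) [∀ n, IsMarkovKernel (post n)]
    (hpost : ∀ n, (μ.map fun ω => ((fun i : Fin n => ω.2 i), ω.1)).IsCondKernel (post n))
    {B : Set Θ} (hB : MeasurableSet B) {C : Set (ℕ → 𝕏)} (hC : MeasurableSet C)
    (hBC : ∀ᵐ ω ∂μ, ω.1 ∈ B ↔ ω.2 ∈ C) :
    ∀ᵐ ω ∂μ, Tendsto (fun n => (post n fun i : Fin n => ω.2 i).real B) atTop
      (𝓝 (B.indicator (fun _ => 1) ω.1)) := by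
  set f : Θ × (ℕ → 𝕏) → ℝ := (Prod.fst ⁻¹' B).indicator fun _ => 1 with hf
  have hfi : Integrable f μ := (integrable_const _).indicator (measurable_fst hB)
  -- The posterior probability of `B` is a version of the conditional expectation of its indicator
  -- given the first `n` observations.
  have hcond : ∀ n, (fun ω : Θ × (ℕ → 𝕏) => (post n fun i : Fin n => ω.2 i).real B) =ᵐ[μ]
      μ[f | obsFiltration Θ 𝕏 n] := by
    intro n
    have hr : Measurable fun (ω : Θ × (ℕ → 𝕏)) (i : Fin n) => ω.2 i := by fun_prop
    have hrp : Measurable fun ω : Θ × (ℕ → 𝕏) => ((fun i : Fin n => ω.2 i), ω.1) := by fun_prop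
    have hpm : Measurable fun y : Fin n → 𝕏 => post n y B := (post n).measurable_coe hB
    refine ae_eq_condExp_of_forall_setIntegral_eq ((obsFiltration Θ 𝕏).le n) hfi ?_ ?_ ?_
    · refine fun s _ _ => Integrable.integrableOn (Integrable.of_bound (C := 1) ?_ ?_)
      · exact (hpm.comp hr).ennreal_toReal.aestronglyMeasurable
      · exact ae_of_all _ fun ω => by
          rw [Real.norm_of_nonneg measureReal_nonneg]
          exact measureReal_le_one
    · rintro _ ⟨S, hS, rfl⟩ _
      rw [hf, integral_indicator_const _ (measurable_fst hB),
        measureReal_restrict_apply (measurable_fst hB), smul_eq_mul, mul_one]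
      simp_rw [measureReal_def]
      rw [integral_toReal (f := fun ω : Θ × (ℕ → 𝕏) => post n (fun i : Fin n => ω.2 i) B)
        (hpm.comp hr).aemeasurable (ae_of_all _ fun ω => measure_lt_top _ _)]
      congr 1
      have h1 : μ (Prod.fst ⁻¹' B ∩ (fun (ω : Θ × (ℕ → 𝕏)) (i : Fin n) => ω.2 i) ⁻¹' S) =
          (μ.map fun ω => ((fun i : Fin n => ω.2 i), ω.1)) (S ×ˢ B) := by
        rw [Measure.map_apply hrp (hS.prod hB)]
        congr 1
        ext ω; simp [and_comm]
      -- Disintegration turns the joint probability of `S ×ˢ B` into the integral of the posterior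
      -- over `S` against the marginal law of the data.
      rw [h1, ← (hpost n).disintegrate, Measure.compProd_apply_prod hS hB,
        Measure.fst_map_prodMk measurable_fst, setLIntegral_map hS hpm hr]
    · exact (hpm.comp (comap_measurable _)).ennreal_toReal.aestronglyMeasurable
  -- The indicator of `B` agrees almost surely with that of `C`, a function of the whole data
  -- sequence, so the limiting conditional expectation leaves it unchanged.
  have hlim : μ[f | ⨆ n, obsFiltration Θ 𝕏 n] =ᵐ[μ] f := by
    refine condExp_of_aestronglyMeasurable' (iSup_le fun n => (obsFiltration Θ 𝕏).le n) ?_ hfi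
    refine ⟨(Prod.snd ⁻¹' C).indicator fun _ => 1, ?_, ?_⟩
    · exact stronglyMeasurable_const.indicator (comap_snd_le_iSup_obsFiltration _ ⟨C, hC, rfl⟩)
    · filter_upwards [hBC] with ω hω
      classical
      rw [hf, Set.indicator_apply, Set.indicator_apply]
      exact if_congr hω rfl rfl
  filter_upwards [tendsto_ae_condExp (ℱ := obsFiltration Θ 𝕏) (μ := μ) f, hlim,
    ae_all_iff.2 hcond] with ω h1 h2 h3
  rw [h2] at h1
  exact h1.congr fun n => (h3 n).symm

end Doob

end FiniteMixture

namespace FiniteMixture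

variable {d : ℕ} {V : Set (EuclideanSpace ℝ (Fin d))}

/-! ### From prior-null to Lebesgue-null sets -/

section NullSets

/-- Recovers a weight vector from all its entries but the last one. -/
def completeWeights {k : ℕ} (u : Fin (k - 1) → ℝ) (j : Fin k) : ℝ :=
  if h : (j : ℕ) < k - 1 then u ⟨j, h⟩ else 1 - ∑ i, u i

lemma completeWeights_truncate {k : ℕ} (w : Weights k) : completeWeights w.truncate = w.1 := by
  funext j
  rw [completeWeights]
  split_ifs with h
  · rfl
  rcases k with _ | k
  · exact j.elim0
  have hj : j = Fin.last k := Fin.ext (by simp at h; simp; omega)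
  have hs := w.2.2
  rw [Fin.sum_univ_castSucc] at hs
  have ht : ∑ i, w.truncate i = ∑ i : Fin k, w.1 i.castSucc := rfl
  rw [ht, hj]
  linarith

/-- In the first `k - 1` coordinates a relabelling is an affine map, and differentiable maps between
spaces of equal dimension preserve null sets. -/
lemma lebesgueWeights_permute_eq_zero {k : ℕ} (σ : Equiv.Perm (Fin k)) {A : Set (Weights k)}
    (hA : lebesgueWeights k A = 0) : lebesgueWeights k {w | w.permute σ ∈ A} = 0 := by
  rw [lebesgueWeights_apply] at hA ⊢
  -- `g` undoes the relabelling: it sends the truncation of `w.permute σ` to that of `w`.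
  let g : (Fin (k - 1) → ℝ) → Fin (k - 1) → ℝ :=
    fun u i => completeWeights u (σ⁻¹ (Fin.castLE (Nat.sub_le k 1) i))
  have hg : Differentiable ℝ g := by
    refine differentiable_pi.2 fun i => ?_
    simp only [g, completeWeights]
    split_ifs <;> fun_prop
  refine measure_mono_null ?_ (addHaar_image_eq_zero_of_differentiableOn_of_addHaar_eq_zero
    volume hg.differentiableOn hA)
  rintro _ ⟨w, hw, rfl⟩
  refine ⟨_, ⟨_, hw, rfl⟩, funext fun i => ?_⟩
  simp only [g, completeWeights_truncate]
  exact congrArg w.1 (σ.apply_symm_apply _)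

/-- Needed for the Fubini criterion for null sets of the product measure. -/
lemma sFinite_lebesgueComponents (hV : MeasurableSet V) (k : ℕ) :
    SFinite (lebesgueComponents V k) := by
  have : StandardBorelSpace V := hV.standardBorel
  have he : MeasurableEmbedding
      (fun (v : Fin k → V) i => (v i : EuclideanSpace ℝ (Fin d))) :=
    Measurable.measurableEmbedding (by fun_prop)
      fun v v' h => funext fun i => Subtype.ext (congrFun h i)
  refine ⟨fun n => Measure.comap (fun v i => (v i : EuclideanSpace ℝ (Fin d)))
    (sfiniteSeq (volume : Measure (Fin k → EuclideanSpace ℝ (Fin d))) n),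
    fun n => inferInstance, ?_⟩
  ext s hs
  rw [Measure.sum_apply _ hs, lebesgueComponents, he.comap_apply]
  simp_rw [he.comap_apply]
  rw [← Measure.sum_apply _ (he.measurableSet_image.2 hs), sum_sfiniteSeq]

variable {π : PMF ℕ+} {D : ∀ k : ℕ+, Measure (Weights k)} {G : ∀ k : ℕ+, Measure (Fin k → V)}

lemma priorLaw_eq_zero_iff (hπ : ∀ k, 0 < π k) {N : Set (Param V)} (hN : MeasurableSet N) :
    priorLaw π D G N = 0 ↔
      ∀ k : ℕ+, (D k).prod (G k) {x | (⟨k, x⟩ : Param V) ∈ N} = 0 := by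
  rw [priorLaw, Measure.sum_apply _ hN, ENNReal.tsum_eq_zero]
  refine forall_congr' fun k => ?_
  rw [Measure.smul_apply, smul_eq_mul, mul_eq_zero, or_iff_right (hπ k).ne',
    Measure.map_apply (measurable_sigmaMk k) hN]
  rfl

lemma isProbabilityMeasure_priorLaw [∀ k, IsProbabilityMeasure (D k)]
    [∀ k, IsProbabilityMeasure (G k)] : IsProbabilityMeasure (priorLaw π D G) := by
  constructor
  rw [priorLaw, Measure.sum_apply _ MeasurableSet.univ, ← π.tsum_coe]
  refine tsum_congr fun k => ?_
  rw [Measure.smul_apply, Measure.map_apply (measurable_sigmaMk k) MeasurableSet.univ]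
  simp

lemma priorLaw_compl_distinctParams [∀ k, IsProbabilityMeasure (D k)]
    [∀ k, IsProbabilityMeasure (G k)] (hprior : PriorCondition π D G) :
    priorLaw π D G (distinctParams V)ᶜ = 0 := by
  rw [priorLaw_eq_zero_iff hprior.pos measurableSet_distinctParams.compl]
  intro k
  have h : {x : Weights k × (Fin k → V) | (⟨k, x⟩ : Param V) ∈ (distinctParams V)ᶜ} ⊆
      Set.univ ×ˢ ⋃ i, ⋃ j, ⋃ _ : i < j, {v : Fin k → V | v i = v j} := by
    rintro ⟨w, v⟩ hx
    change ¬ Function.Injective v at hx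
    simp only [Function.Injective, not_forall] at hx
    obtain ⟨i, j, hij, hne⟩ := hx
    simp only [Set.mem_prod, Set.mem_univ, true_and, Set.mem_iUnion]
    rcases lt_or_gt_of_ne hne with hlt | hlt
    exacts [⟨i, j, hlt, hij⟩, ⟨j, i, hlt, hij.symm⟩]
  refine measure_mono_null h ?_
  rw [Measure.prod_prod]
  refine mul_eq_zero_of_right _ ?_
  exact measure_iUnion_null fun i => measure_iUnion_null fun j => measure_iUnion_null fun hij =>
    hprior.distinct k i j hij

/-- A permutation invariant set of prior probability zero is Lebesgue-null. -/
lemma lebesgueParam_eq_zero (hV : MeasurableSet V) [∀ k, IsProbabilityMeasure (G k)]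
    (hprior : PriorCondition π D G) {N : Set (Param V)}
    (hN : MeasurableSet N) (hinv : PermInvariant N) (h0 : priorLaw π D G N = 0) :
    lebesgueParam V N = 0 := by
  rw [priorLaw_eq_zero_iff hprior.pos hN] at h0
  rw [lebesgueParam, Measure.sum_apply _ hN, ENNReal.tsum_eq_zero]
  intro k
  have := sFinite_lebesgueComponents hV k
  set M : Set (Weights k × (Fin k → V)) := {x | (⟨k, x⟩ : Param V) ∈ N} with hM
  have hMm : MeasurableSet M := measurable_sigmaMk k hN
  rw [Measure.map_apply (measurable_sigmaMk k) hN]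
  change (lebesgueWeights k).prod (lebesgueComponents V k) M = 0
  rw [Measure.measure_prod_null hMm]
  have hD := (Measure.measure_prod_null hMm).1 (h0 k)
  have hA : lebesgueWeights k {w | G k (Prod.mk w ⁻¹' M) ≠ 0} = 0 := by
    rw [lebesgueWeights_apply]
    refine hprior.weights k _ ?_ hD
    exact measurable_measure_prodMk_left hMm (measurableSet_singleton 0).compl
  -- The assumption on `G k` involves every relabelling of the components, so the sections at all
  -- relabelled weights must be `G k`-null together.
  have hAσ : ∀ᵐ w ∂lebesgueWeights k, ∀ σ : Equiv.Perm (Fin k),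
      G k (Prod.mk (w.permute σ) ⁻¹' M) = 0 := by
    refine ae_all_iff.2 fun σ => ?_
    exact lebesgueWeights_permute_eq_zero σ hA
  filter_upwards [hAσ] with w hw
  refine hprior.components k _ (measurable_prodMk_left hMm) (Finset.sum_eq_zero fun σ _ => ?_)
  -- If `(w, v_σ)` lies in `N`, relabelling by `σ⁻¹` puts `(w_{σ⁻¹}, v)` in `N`; so `v` lies in the
  -- section at `w.permute σ⁻¹`, which is null.
  refine measure_mono_null (fun v hv => ?_) (hw σ⁻¹)
  have h1 := hinv _ hv σ⁻¹
  have h2 : (fun i => v (σ (σ⁻¹ i))) = v := funext fun i => congrArg v (σ.apply_symm_apply i)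
  change (⟨k, w.permute σ⁻¹, fun i => v (σ (σ⁻¹ i))⟩ : Param V) ∈ N at h1
  rwa [h2] at h1

end NullSets

/-! ### Permutation invariant neighbourhoods -/

section Neighbourhoods

lemma paramDist_mk (k : ℕ+) (x y : Weights k × (Fin k → V)) :
    paramDist (⟨k, x⟩ : Param V) ⟨k, y⟩ =
      min (Real.sqrt (∑ i, (x.1.1 i - y.1.1 i) ^ 2 +
        ∑ i, ‖(x.2 i : EuclideanSpace ℝ (Fin d)) - y.2 i‖ ^ 2)) 1 :=
  dif_pos rfl

lemma continuous_paramDist_mk (k : ℕ+) (y : Weights k × (Fin k → V)) :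
    Continuous fun x => paramDist (⟨k, x⟩ : Param V) ⟨k, y⟩ := by
  simp only [paramDist_mk]
  refine (Real.continuous_sqrt.comp (Continuous.add ?_ ?_)).min continuous_const
  · refine continuous_finsetSum _ fun i _ => ?_
    exact (((continuous_apply i).comp (continuous_subtype_val.comp continuous_fst)).sub
      continuous_const).pow 2
  · refine continuous_finsetSum _ fun i _ => ?_
    exact ((continuous_subtype_val.comp ((continuous_apply i).comp continuous_snd)).sub
      continuous_const).norm.pow 2

lemma paramDist_permute (k : ℕ+) (x y : Weights k × (Fin k → V)) (σ : Equiv.Perm (Fin k)) :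
    paramDist (Param.permute (⟨k, x⟩ : Param V) σ) (Param.permute ⟨k, y⟩ σ) =
      paramDist (⟨k, x⟩ : Param V) ⟨k, y⟩ := by
  refine (paramDist_mk k (x.1.permute σ, fun i => x.2 (σ i))
    (y.1.permute σ, fun i => y.2 (σ i))).trans ?_
  rw [paramDist_mk]
  congr 3
  · exact Equiv.sum_comp σ fun i => (x.1.1 i - y.1.1 i) ^ 2
  · exact Equiv.sum_comp σ fun i => ‖(x.2 i : EuclideanSpace ℝ (Fin d)) - y.2 i‖ ^ 2

lemma paramDist_self (θ : Param V) : paramDist θ θ = 0 := by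
  rcases θ with ⟨k, x⟩
  rw [paramDist_mk]
  simp

lemma permBall_subset_numComponents (θ₀ : Param V) :
    permBall θ₀ 1 ⊆ {θ | θ.numComponents = θ₀.numComponents} := by
  intro θ hθ
  obtain ⟨σ, hσ⟩ := Set.mem_iUnion.1 hθ
  by_contra h
  have h1 : paramDist θ (θ₀.permute σ) = 1 := dif_neg h
  exact lt_irrefl (1 : ℝ) (h1 ▸ hσ)

/-- The parameters with a relabelling in the set `U` of parameters with `k` components. -/
def permSaturation (k : ℕ+) (U : Set (Weights k × (Fin k → V))) : Set (Param V) :=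
  {θ | ∃ σ, ∃ x ∈ U, θ.permute σ = ⟨k, x⟩}

lemma permInvariant_permSaturation (k : ℕ+) (U : Set (Weights k × (Fin k → V))) :
    PermInvariant (permSaturation k U) := by
  rintro θ ⟨σ, x, hx, h⟩ τ
  refine ⟨τ⁻¹ * σ, x, hx, ?_⟩
  rw [← h]
  refine (θ.permute_permute τ (τ⁻¹ * σ)).trans ?_
  rw [mul_inv_cancel_left]

lemma measurable_permute (k : ℕ+) (σ : Equiv.Perm (Fin k)) :
    Measurable fun x : Weights k × (Fin k → V) => (x.1.permute σ, fun i => x.2 (σ i)) := by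
  refine Measurable.prodMk (Measurable.subtype_mk ?_) (by fun_prop)
  exact measurable_pi_lambda _ fun i =>
    (measurable_pi_apply (σ i)).comp (measurable_subtype_coe.comp measurable_fst)

lemma measurableSet_permSaturation (k : ℕ+) {U : Set (Weights k × (Fin k → V))}
    (hU : MeasurableSet U) : MeasurableSet (permSaturation k U) := by
  refine MeasurableSpace.measurableSet_iInf.2 fun k' => ?_
  change MeasurableSet {x : Weights k' × (Fin k' → V) | (⟨k', x⟩ : Param V) ∈ permSaturation k U}
  by_cases hk : k' = k
  · subst hk
    have h : {x : Weights k' × (Fin k' → V) | (⟨k', x⟩ : Param V) ∈ permSaturation k' U} =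
        ⋃ σ : Equiv.Perm (Fin k'),
          (fun x : Weights k' × (Fin k' → V) => (x.1.permute σ, fun i => x.2 (σ i))) ⁻¹' U := by
      ext x
      refine Iff.trans ?_ Set.mem_iUnion.symm
      refine exists_congr fun σ => ⟨?_, fun h => ⟨_, h, rfl⟩⟩
      rintro ⟨y, hy, h⟩
      have hxy : (x.1.permute σ, fun i => x.2 (σ i)) = y := eq_of_heq (Sigma.mk.inj h).2
      exact (congrArg (· ∈ U) hxy).mpr hy
    rw [h]
    exact MeasurableSet.iUnion fun σ => measurable_permute k' σ hU
  · convert MeasurableSet.empty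
    refine Set.eq_empty_of_forall_notMem fun x => ?_
    rintro ⟨σ, y, -, h⟩
    exact hk (congrArg Sigma.fst h)

/-- The distance is unchanged when both arguments are relabelled together, so `θ[σ]` close to `y`
means `θ` close to `y[σ⁻¹]`. -/
lemma permSaturation_subset_permBall {k : ℕ+} {U : Set (Weights k × (Fin k → V))}
    {y : Weights k × (Fin k → V)} {ε : ℝ} (hU : ∀ x ∈ U, paramDist (⟨k, x⟩ : Param V) ⟨k, y⟩ < ε) :
    permSaturation k U ⊆ permBall ⟨k, y⟩ ε := by
  rintro ⟨k', z⟩ ⟨σ, x, hx, h⟩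
  obtain rfl : k' = k := congrArg Sigma.fst h
  refine Set.mem_iUnion.2 ⟨σ⁻¹, ?_⟩
  have h1 := hU x hx
  rw [← paramDist_permute k' x y σ⁻¹] at h1
  have h2 : Param.permute (⟨k', x⟩ : Param V) σ⁻¹ = ⟨k', z⟩ := by
    obtain rfl : (z.1.permute σ, fun i => z.2 (σ i)) = x := eq_of_heq (Sigma.mk.inj h).2
    exact Param.permute_permute_inv (⟨k', z⟩ : Param V) σ
  exact h2 ▸ h1

end Neighbourhoods

/-! ### Posterior consistency outside an invariant null set -/

section Consistency

variable {𝕏 : Type*} [MeasurableSpace 𝕏]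

lemma ae_tendsto_posterior_permInvariant [StandardBorelSpace 𝕏] (hV : MeasurableSet V)
    {F : V → Measure 𝕏} [∀ v, IsProbabilityMeasure (F v)] (hF : ComponentCondition F)
    {Q : Measure (Param V)} [IsProbabilityMeasure Q] (hQ : Q (distinctParams V)ᶜ = 0)
    (post : ∀ n : ℕ, Kernel (Fin n → 𝕏) (Param V)) [∀ n, IsMarkovKernel (post n)]
    (hpost : ∀ n, (jointLaw F Q n).IsCondKernel (post n))
    {B : Set (Param V)} (hB : MeasurableSet B) (hBinv : PermInvariant B) :
    ∀ᵐ θ ∂Q, θ ∈ B → ∀ᵐ x ∂dataKernel F hF θ,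
      Tendsto (fun n : ℕ => post n (fun i : Fin n => x i) B) atTop (𝓝 1) := by
  obtain ⟨A, hA, hsep⟩ := exists_seq_measurableSet_separating 𝕏
  obtain ⟨C, hC, hBC⟩ := exists_measurableSet_mem_iff hV hF hA hsep hB hBinv
  have hL : Measurable fun (x : ℕ → 𝕏) m => limFreq (A m) x :=
    measurable_pi_lambda _ fun m => measurable_limFreq (hA m)
  have hiff : ∀ᵐ ω ∂(Q ⊗ₘ dataKernel F hF),
      ω.1 ∈ B ↔ ω.2 ∈ (fun (x : ℕ → 𝕏) m => limFreq (A m) x) ⁻¹' C := by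
    refine Measure.ae_compProd_of_ae_ae ?_ ?_
    · exact measurableSet_setOfPred.2 (Measurable.iff (measurableSet_setOfPred.1 (measurable_fst hB))
        (measurableSet_setOfPred.1 (measurable_snd (hL hC))))
    · filter_upwards [measure_eq_zero_iff_ae_notMem.1 hQ] with θ hθ
      have h := ae_all_iff.2 fun m => ae_limFreq_eq (dataLaw F θ) (hA m)
      rw [dataKernel_apply]
      filter_upwards [h] with x hx
      rw [hBC θ (not_not.1 hθ), Set.mem_preimage, funext hx]
  have hdoob := ae_tendsto_posterior (Q ⊗ₘ dataKernel F hF) post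
    (fun n => by rw [map_compProd_dataKernel]; exact hpost n) hB (hL hC) hiff
  filter_upwards [Measure.ae_ae_of_ae_compProd hdoob] with θ hθ hθB
  filter_upwards [hθ] with x hx
  rw [Set.indicator_of_mem hθB] at hx
  refine (ENNReal.tendsto_toReal_iff (fun n => measure_ne_top _ _) ENNReal.one_ne_top).1 ?_
  exact hx

/-- The parameters with distinct components at which the posterior probability of each
neighbourhood from a countable family of permutation invariant sets is consistent. -/
def consistentParams (F : V → Measure 𝕏) [∀ v, IsProbabilityMeasure (F v)]
    (hF : ComponentCondition F) (post : ∀ n : ℕ, Kernel (Fin n → 𝕏) (Param V))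
    {ι : Type*} (B : ι → Set (Param V)) : Set (Param V) :=
  distinctParams V ∩ ⋂ j, {θ | θ ∈ B j → ∀ᵐ x ∂dataKernel F hF θ,
    Tendsto (fun n : ℕ => post n (fun i : Fin n => x i) (B j)) atTop (𝓝 1)}

variable {F : V → Measure 𝕏} [∀ v, IsProbabilityMeasure (F v)] {hF : ComponentCondition F}
  {post : ∀ n : ℕ, Kernel (Fin n → 𝕏) (Param V)} {ι : Type*} {B : ι → Set (Param V)}

lemma measurableSet_consistentParams [Countable ι] (hB : ∀ j, MeasurableSet (B j)) :
    MeasurableSet (consistentParams F hF post B) := by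
  refine measurableSet_distinctParams.inter (MeasurableSet.iInter fun j => ?_)
  have hE : MeasurableSet {x : ℕ → 𝕏 |
      Tendsto (fun n : ℕ => post n (fun i : Fin n => x i) (B j)) atTop (𝓝 1)} := by
    refine measurableSet_tendsto (𝓝 1) fun n => ?_
    exact ((post n).measurable_coe (hB j)).comp (by fun_prop)
  -- The implication is a union, and its almost sure conclusion says that the kernel gives the
  -- divergence event mass zero, a measurable condition on `θ`.
  refine MeasurableSet.congr ((hB j).compl.union
    ((dataKernel F hF).measurable_coe hE.compl (measurableSet_singleton 0))) ?_
  ext θ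
  exact imp_iff_not_or.symm

/-- Both the data law and membership in each `B j` are unchanged by relabelling. -/
lemma permInvariant_consistentParams (hB : ∀ j, PermInvariant (B j)) :
    PermInvariant (consistentParams F hF post B) := by
  refine permInvariant_distinctParams.inter fun θ hθ σ => Set.mem_iInter.2 fun j hj => ?_
  rw [dataKernel_apply, dataLaw_permute]
  refine Set.mem_iInter.1 hθ j ?_
  by_contra h
  exact (hB j).compl θ h σ hj

end Consistency

end FiniteMixture

/-! ### The consistency theorem -/

theorem theorem2 {d : ℕ} {V : Set (EuclideanSpace ℝ (Fin d))} (hV : MeasurableSet V)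
    {𝕏 : Type*} [MeasurableSpace 𝕏] [StandardBorelSpace 𝕏]
    (F : V → Measure 𝕏) [∀ v, IsProbabilityMeasure (F v)]
    (π : PMF ℕ+)
    (D : ∀ k : ℕ+, Measure (FiniteMixture.Weights k)) [∀ k, IsProbabilityMeasure (D k)]
    (G : ∀ k : ℕ+, Measure (Fin k → V)) [∀ k, IsProbabilityMeasure (G k)]
    (hF : FiniteMixture.ComponentCondition F)
    (hprior : FiniteMixture.PriorCondition π D G)
    -- any version of the posterior distribution of `θ` given `X_1, …, X_n`, for each `n`
    (post : ∀ n : ℕ, Kernel (Fin n → 𝕏) (FiniteMixture.Param V))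
    [∀ n, IsMarkovKernel (post n)]
    (hpost : ∀ n, (FiniteMixture.jointLaw F (FiniteMixture.priorLaw π D G) n).IsCondKernel
      (post n)) :
    ∃ Θstar : Set (FiniteMixture.Param V), MeasurableSet Θstar ∧
      FiniteMixture.priorLaw π D G Θstar = 1 ∧
      FiniteMixture.lebesgueParam V Θstarᶜ = 0 ∧
      ∀ θ₀ ∈ Θstar,
        (∀ ε : ℝ, 0 < ε →
          ∀ᵐ x ∂(Measure.infinitePi fun _ : ℕ => FiniteMixture.dataLaw F θ₀),
            Tendsto (fun n : ℕ => post n (fun i : Fin n => x i)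
              (FiniteMixture.permBall θ₀ ε)) atTop (𝓝 1)) ∧
        ∀ᵐ x ∂(Measure.infinitePi fun _ : ℕ => FiniteMixture.dataLaw F θ₀),
          Tendsto (fun n : ℕ => post n (fun i : Fin n => x i)
            {θ | θ.numComponents = θ₀.numComponents}) atTop (𝓝 1) := by
  open FiniteMixture in
  have : IsProbabilityMeasure (priorLaw π D G) := isProbabilityMeasure_priorLaw
  -- The balls around all `θ₀` are uncountably many; a countable basis for each `k` keeps the union
  -- of exceptional sets null.
  let ι : Type := Σ k : ℕ+, TopologicalSpace.countableBasis (Weights k × (Fin k → V))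
  let B : ι → Set (Param V) := fun j => distinctParams V ∩ permSaturation j.1 j.2.1
  have hBm : ∀ j, MeasurableSet (B j) := fun j => measurableSet_distinctParams.inter
    (measurableSet_permSaturation _
      (TopologicalSpace.isOpen_of_mem_countableBasis j.2.2).measurableSet)
  have hBinv : ∀ j, PermInvariant (B j) := fun j =>
    permInvariant_distinctParams.inter (permInvariant_permSaturation _ _)
  have hdist := priorLaw_compl_distinctParams hprior
  have hmeas : MeasurableSet (consistentParams F hF post B) := measurableSet_consistentParams hBm
  have hnull : priorLaw π D G (consistentParams F hF post B)ᶜ = 0 := by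
    have h := ae_all_iff.2 fun j => ae_tendsto_posterior_permInvariant hV hF hdist post hpost
      (hBm j) (hBinv j)
    change ∀ᵐ θ ∂priorLaw π D G, θ ∈ consistentParams F hF post B
    filter_upwards [h, measure_eq_zero_iff_ae_notMem.1 hdist] with θ h1 h2
    exact ⟨not_not.1 h2, Set.mem_iInter.2 h1⟩
  refine ⟨consistentParams F hF post B, hmeas, (prob_compl_eq_zero_iff hmeas).1 hnull,
    lebesgueParam_eq_zero hV hprior hmeas.compl (permInvariant_consistentParams hBinv).compl hnull,
    fun θ₀ hθ₀ => ?_⟩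
  have hball : ∀ ε : ℝ, 0 < ε →
      ∀ᵐ x ∂(Measure.infinitePi fun _ : ℕ => dataLaw F θ₀),
        Tendsto (fun n : ℕ => post n (fun i : Fin n => x i) (permBall θ₀ ε)) atTop (𝓝 1) := by
    intro ε hε
    obtain ⟨k, y⟩ := θ₀
    obtain ⟨U, hU, hyU, hUε⟩ :=
      (TopologicalSpace.isBasis_countableBasis _).exists_subset_of_mem_open
        (show y ∈ {x | paramDist (⟨k, x⟩ : Param V) ⟨k, y⟩ < ε} from
          (paramDist_self (⟨k, y⟩ : Param V)).trans_lt hε)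
        (isOpen_lt (continuous_paramDist_mk k y) continuous_const)
    have hy : (⟨k, y⟩ : Param V) ∈ B ⟨k, U, hU⟩ := ⟨hθ₀.1, 1, y, hyU, rfl⟩
    have hsub : B ⟨k, U, hU⟩ ⊆ permBall ⟨k, y⟩ ε :=
      Set.inter_subset_right.trans (permSaturation_subset_permBall hUε)
    filter_upwards [Set.mem_iInter.1 hθ₀.2 ⟨k, U, hU⟩ hy] with x hx
    exact tendsto_of_tendsto_of_tendsto_of_le_of_le hx tendsto_const_nhds
      (fun n => measure_mono hsub) fun n => prob_le_one
  refine ⟨hball, ?_⟩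
  -- Parameters with different numbers of components are at distance exactly `1`, so radius `1`
  -- excludes them.
  filter_upwards [hball 1 one_pos] with x hx
  exact tendsto_of_tendsto_of_tendsto_of_le_of_le hx tendsto_const_nhds
    (fun n => measure_mono (permBall_subset_numComponents θ₀)) fun n => prob_le_one
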